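/- There is an absolute constant $C>0$ such that the following holds for all integers $m\ge 1$, $n\ge 0$, $t\ge 0$. Let $\mathcal H_n$ be the Haar distribution on $n$-qubit pure states (the normalized surface measure on the unit sphere of $\mathbb C^{2^n}$). Let $\mathsf P=(\mathsf P_1,\dots,\mathsf P_m)$, where each register $\mathsf P_i$ consists of $t$ blocks of $n$ qubits, and let \[ \rho_{\mathsf P}:=\mathop{\mathbb E}_{|\psi\rangle\leftarrow\mathcal H_n}\Big[\bigotimes_{i=1}^m |\psi\rangle\langle\psi|^{\otimes t}_{\mathsf P_i}\Big], \qquad \sigma_{\mathsf P}:=\bigotimes_{i=1}^m\ \mathop{\mathbb E}_{|\psi_i\rangle\leftarrow\mathcal H_n}\Big[|\psi_i\rangle\langle\psi_i|^{\otimes t}_{\mathsf P_i}\Big]. \] Then $\rho_{\mathsf P}$ and $\sigma_{\mathsf P}$ are $(m,\,C\,m^2t^2/2^n)$-LOCC indistinguishable: for every $m$-party LOCC adversary $(P_1,\dots,P_m)$ in which $P_i$ receives register $\mathsf P_i$ and $P_m$ outputs a bit, \[ \Big|\Pr\big[(P_1,\dots,P_m)(\rho_{\mathsf P})=1\big]-\Pr\big[(P_1,\dots,P_m)(\sigma_{\mathsf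 P})=1\big]\Big|\le C\,\frac{m^2t^2}{2^n}. \] Here an $m$-party LOCC adversary consists of $m$ computationally unbounded parties without pre-shared entanglement, who for an arbitrary finite number of rounds apply quantum instruments with finitely many outcomes to their own finite-dimensional registers and communicate classically, each operation being allowed to depend on all earlier messages. -/

import Mathlib

open MeasureTheory

namespace HaarLOCC

/-! ### States -/

/-- Labels of the computational basis of an `n`-qubit register: bit strings of length `n`. -/
abbrev Bits (n : ℕ) : Type := Fin n → Bool

/-- The Hilbert space of `n` qubits. -/
abbrev QubitSpace (n : ℕ) : Type := EuclideanSpace ℂ (Bits n)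

/-- The Haar distribution on `n`-qubit pure states: the surface measure on the unit sphere of
`ℂ^(2^n)`, normalized to total mass one. -/
noncomputable def haarState (n : ℕ) : Measure (Metric.sphere (0 : QubitSpace n) 1) :=
  ((volume : Measure (QubitSpace n)).toSphere Set.univ)⁻¹ •
    (volume : Measure (QubitSpace n)).toSphere

instance (n : ℕ) : IsProbabilityMeasure (haarState n) := by
  have h0 : (volume : Measure (QubitSpace n)).toSphere ≠ 0 := by
    rw [Ne, Measure.toSphere_eq_zero_iff_finrank]
    have : 0 < Module.finrank ℝ (QubitSpace n) := Module.finrank_pos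
    omega
  refine ⟨?_⟩
  rw [haarState, Measure.smul_apply, smul_eq_mul]
  exact ENNReal.inv_mul_cancel (by rwa [Ne, Measure.measure_univ_eq_zero]) (measure_ne_top _ _)

/-- The rank-one matrix `|v⟩⟨v|` in the computational basis. -/
noncomputable def ketbra {n : ℕ} (v : QubitSpace n) : Matrix (Bits n) (Bits n) ℂ :=
  Matrix.vecMulVec (fun x => v x) (fun x => star (v x))

/-- The tensor (Kronecker) product of a finite family of matrices. The product basis of the
tensor product of spaces with bases `R i` is indexed by `∀ i, R i`. -/
def tensor {ι : Type} [Fintype ι] {R S : ι → Type} (K : ∀ i, Matrix (S i) (R i) ℂ) :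
    Matrix (∀ i, S i) (∀ i, R i) ℂ :=
  Matrix.of fun a b => ∏ i, K i (a i) (b i)

/-- `|v⟩⟨v|^{⊗ t}`, a matrix on a register of `t` blocks of `n` qubits. -/
noncomputable def copies (t : ℕ) {n : ℕ} (v : QubitSpace n) :
    Matrix (Fin t → Bits n) (Fin t → Bits n) ℂ :=
  tensor fun _ : Fin t => ketbra v

/-- The register of each party: `t` blocks of `n` qubits. -/
abbrev PartyReg (m n t : ℕ) : Fin m → Type := fun _ => Fin t → Bits n

/-- `E_ψ [⨂_{i=1}^m |ψ⟩⟨ψ|^{⊗ t}]`: the parties hold copies of one and the same Haar state.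
The expectation of a random matrix is taken entry by entry. -/
noncomputable def sharedState (m n t : ℕ) :
    Matrix (∀ i, PartyReg m n t i) (∀ i, PartyReg m n t i) ℂ :=
  Matrix.of fun a b => ∫ ψ, (tensor fun _ : Fin m => copies t ψ.1) a b ∂(haarState n)

/-- `E_ψ [|ψ⟩⟨ψ|^{⊗ t}]`: `t` copies of a single Haar state. -/
noncomputable def haarCopies (n t : ℕ) : Matrix (Fin t → Bits n) (Fin t → Bits n) ℂ :=
  Matrix.of fun a b => ∫ ψ, copies t ψ.1 a b ∂(haarState n)

/-- `⨂_{i=1}^m E_{ψ_i} [|ψ_i⟩⟨ψ_i|^{⊗ t}]`: each party holds copies of its own Haar state,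
independent of those of the others. -/
noncomputable def independentState (m n t : ℕ) :
    Matrix (∀ i, PartyReg m n t i) (∀ i, PartyReg m n t i) ℂ :=
  tensor fun _ : Fin m => haarCopies n t

/-! ### LOCC protocols -/

/-- A quantum instrument from a system with basis `R` to a system with basis `S`, with classical
outcomes in `Ω`, in Kraus form. On outcome `w` it maps a state `X` to the subnormalized state
`∑ k, K w k * X * (K w k)ᴴ`, whose trace is the probability of `w`. The index `k` is not
recorded, so an outcome need not be given by a single Kraus operator; `R` and `S` may differ,
so ancillas may be added and subsystems discarded. -/
structure Instrument (R S Ω : Type) [Fintype R] [DecidableEq R] [Fintype S] [Fintype Ω] where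
  /-- the number of Kraus operators per outcome -/
  rank : ℕ
  /-- the Kraus operators -/
  K : Ω → Fin rank → Matrix S R ℂ
  /-- summed over all outcomes, the instrument preserves the trace -/
  complete : ∑ w, ∑ k, (K w k).conjTranspose * K w k = 1

/-- An `m`-party LOCC adversary, run on local registers with bases `R i`.

In a round each party `i` applies an instrument to its own register and announces the
classical outcome `w i` to everybody; what is done afterwards may depend on all outcomes
announced so far. (A party that is idle, or that has nothing to announce, uses an instrument with
one outcome; the unannounced information stays in its register.) After finitely many rounds, the
last party outputs a bit, which is determined by the classical transcript, hence in particular by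
the outcomes of its own measurements. No bound is put on the number of rounds, the length of the
messages, or the size of the registers. -/
inductive Protocol (m : ℕ) : (R : Fin m → Type) → [∀ i, Fintype (R i)] →
    [∀ i, DecidableEq (R i)] → Type 1
  | output {R : Fin m → Type} [∀ i, Fintype (R i)] [∀ i, DecidableEq (R i)] (b : Bool) :
      Protocol m R
  | round {R : Fin m → Type} [∀ i, Fintype (R i)] [∀ i, DecidableEq (R i)]
      (S : Fin m → Type) [∀ i, Fintype (S i)] [∀ i, DecidableEq (S i)]
      (Ω : Fin m → Type) [∀ i, Fintype (Ω i)]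
      (I : ∀ i, Instrument (R i) (S i) (Ω i))
      (next : (∀ i, Ω i) → Protocol m S) : Protocol m R

/-- The joint, subnormalized state after a round in which party `i` applies `I i` and obtains
the outcome `w i`: the image of `ρ` under the tensor product of the local maps. -/
noncomputable def postState {m : ℕ} {R S Ω : Fin m → Type}
    [∀ i, Fintype (R i)] [∀ i, DecidableEq (R i)] [∀ i, Fintype (S i)] [∀ i, Fintype (Ω i)]
    (I : ∀ i, Instrument (R i) (S i) (Ω i)) (w : ∀ i, Ω i)
    (ρ : Matrix (∀ i, R i) (∀ i, R i) ℂ) : Matrix (∀ i, S i) (∀ i, S i) ℂ :=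
  ∑ k : ∀ i, Fin (I i).rank,
    tensor (fun i => (I i).K (w i) (k i)) * ρ *
      (tensor (fun i => (I i).K (w i) (k i))).conjTranspose

/-- The probability that the adversary outputs `1` on the joint input state `ρ`. On a
subnormalized `ρ` this is the joint probability with the event that led to `ρ`. -/
noncomputable def Protocol.prob {m : ℕ} : {R : Fin m → Type} → [∀ i, Fintype (R i)] →
    [∀ i, DecidableEq (R i)] → Protocol m R → Matrix (∀ i, R i) (∀ i, R i) ℂ → ℝ
  | _, _, _, @Protocol.output _ _ _ _ b => fun ρ => if b then ρ.trace.re else 0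
  | _, _, _, @Protocol.round _ _ _ _ _ _ _ Ω _ I next => fun ρ =>
      ∑ w : ∀ i, Ω i, (next w).prob (postState I w ρ)

/-- `(m, ε)`-LOCC indistinguishability of two states on `m` registers. -/
def LOCCIndistinguishable {m : ℕ} {R : Fin m → Type} [∀ i, Fintype (R i)]
    [∀ i, DecidableEq (R i)] (ε : ℝ) (ρ σ : Matrix (∀ i, R i) (∀ i, R i) ℂ) : Prop :=
  ∀ P : Protocol m R, |P.prob ρ - P.prob σ| ≤ ε

end HaarLOCC

/-!
After any number of rounds, the operator that an LOCC adversary has applied to the input is a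
tensor product of Kraus operators. Acceptance probabilities therefore only see the quadratic form
of the input on product vectors, and two states `ρ`, `σ` of trace one are `ε`-indistinguishable as
soon as the forms of `σ` and of `ρ - (1 - ε) σ` are nonnegative there.

For `N = 2 ^ n`, the form of `t` copies of a Haar state at a vector `x` is the second moment of a
homogeneous polynomial `P` of degree `t` on the unit sphere of `ℂ ^ N`. By integration of Gaussian
monomials in polar coordinates it equals `[P, P] / (N (N + 1) ⋯ (N + t - 1))`, where `[P, Q]` is
the Fischer form. At a product vector, the shared state gives the polynomial `∏ Pᵢ` of degree
`m t`, and the independent states give the product of the second moments of the `Pᵢ`. Bombieri's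
inequality `∏ [Pᵢ, Pᵢ] ≤ [∏ Pᵢ, ∏ Pᵢ]` reduces the claim to a comparison of rising factorials, in
which the factor `1 - (m t)² / N` is lost.
-/

namespace HaarLOCC

open Finset MvPolynomial Matrix
open scoped ComplexOrder

section Fischer

universe u

variable {σ : Type u} [Fintype σ]

/-- The Fischer inner product of two polynomials, conjugate-linear in the first one: monomials are
orthogonal and `X ^ α` has squared norm `α!`. For this product multiplication by `X i` is adjoint
to `∂/∂X i`. -/
noncomputable def fischerForm : MvPolynomial σ ℂ →ₗ⋆[ℂ] MvPolynomial σ ℂ →ₗ[ℂ] ℂ :=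
  have sum_eq {P : MvPolynomial σ ℂ} {T : Finset (σ →₀ ℕ)} (hT : P.support ⊆ T)
      (Q : MvPolynomial σ ℂ) :
      ∑ α ∈ P.support, (∏ i, ((α i).factorial : ℂ)) * (star (P.coeff α) * Q.coeff α) =
        ∑ α ∈ T, (∏ i, ((α i).factorial : ℂ)) * (star (P.coeff α) * Q.coeff α) :=
    sum_subset hT fun α _ h => by simp [notMem_support_iff.1 h]
  LinearMap.mk₂'ₛₗ (starRingEnd ℂ) (RingHom.id ℂ)
    (fun P Q => ∑ α ∈ P.support, (∏ i, ((α i).factorial : ℂ)) * (star (P.coeff α) * Q.coeff α))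
    (fun P P' Q => by
      classical
      rw [sum_eq support_add, sum_eq subset_union_left, sum_eq (P := P') subset_union_right,
        ← sum_add_distrib]
      exact sum_congr rfl fun α _ => by rw [coeff_add, star_add, add_mul, mul_add])
    (fun c P Q => by
      rw [sum_eq support_smul, smul_eq_mul, mul_sum]
      exact sum_congr rfl fun α _ => by
        rw [coeff_smul, smul_eq_mul, star_mul', Complex.star_def]; ring)
    (fun P Q Q' => by simp only [coeff_add, mul_add, sum_add_distrib])
    (fun c P Q => by
      simp only [coeff_smul, smul_eq_mul, mul_sum, RingHom.id_apply]
      exact sum_congr rfl fun α _ => by ring)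

lemma fischerForm_apply (P Q : MvPolynomial σ ℂ) : fischerForm P Q =
    ∑ α ∈ P.support, (∏ i, ((α i).factorial : ℂ)) * (star (P.coeff α) * Q.coeff α) :=
  rfl

lemma star_fischerForm (P Q : MvPolynomial σ ℂ) : star (fischerForm P Q) = fischerForm Q P := by
  classical
  have sum_inter (P Q : MvPolynomial σ ℂ) : fischerForm P Q = ∑ α ∈ P.support ∩ Q.support,
      (∏ i, ((α i).factorial : ℂ)) * (star (P.coeff α) * Q.coeff α) :=
    (sum_subset inter_subset_left fun α hP h => by
      rw [notMem_support_iff.1 fun hQ => h (mem_inter.2 ⟨hP, hQ⟩), mul_zero, mul_zero]).symm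
  rw [sum_inter P, sum_inter Q, inter_comm, star_sum]
  refine sum_congr rfl fun α _ => ?_
  simp only [star_mul', star_prod, star_natCast, star_star]
  ring

lemma fischerForm_self_nonneg (P : MvPolynomial σ ℂ) : 0 ≤ fischerForm P P :=
  sum_nonneg fun _ _ =>
    mul_nonneg (prod_nonneg fun _ _ => Nat.cast_nonneg _) (star_mul_self_nonneg _)

lemma fischerForm_one_one : fischerForm (1 : MvPolynomial σ ℂ) 1 = 1 := by
  classical
  simp [fischerForm_apply, MvPolynomial.support_one]

lemma fischerForm_X_mul_left (i : σ) (P Q : MvPolynomial σ ℂ) :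
    fischerForm (X i * P) Q = fischerForm P (pderiv i Q) := by
  classical
  rw [fischerForm_apply, fischerForm_apply, support_X_mul, sum_map]
  refine sum_congr rfl fun α _ => ?_
  have factorial_add_single : ∏ j, (((Finsupp.single i 1 + α : σ →₀ ℕ) j).factorial : ℂ) =
      (∏ j, ((α j).factorial : ℂ)) * (α i + 1) := by
    rw [← mul_prod_erase univ _ (mem_univ i), ← mul_prod_erase univ _ (mem_univ i),
      prod_congr rfl fun j hj => by
        rw [Finsupp.add_apply, Finsupp.single_eq_of_ne (ne_of_mem_erase hj), zero_add]]
    simp only [Finsupp.add_apply, Finsupp.single_eq_same, add_comm 1, Nat.factorial_succ]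
    push_cast
    ring
  rw [addLeftEmbedding_apply, factorial_add_single, coeff_X_mul, coeff_pderiv, add_comm α]
  ring

lemma fischerForm_X_mul_right (i : σ) (P Q : MvPolynomial σ ℂ) :
    fischerForm P (X i * Q) = fischerForm (pderiv i P) Q := by
  rw [← star_fischerForm, fischerForm_X_mul_left, star_fischerForm]

lemma sum_fischerForm_pderiv_mul_left {P : MvPolynomial σ ℂ} {d : ℕ} (hP : P.IsHomogeneous d)
    (Q R : MvPolynomial σ ℂ) :
    ∑ i, fischerForm (pderiv i P * Q) (pderiv i R) = d * fischerForm (P * Q) R := by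
  simp_rw [← fischerForm_X_mul_left, ← mul_assoc]
  rw [← LinearMap.sum_apply, ← map_sum, ← sum_mul, hP.sum_X_mul_pderiv, smul_mul_assoc, map_nsmul,
    LinearMap.smul_apply, nsmul_eq_mul]

lemma sum_fischerForm_pderiv_mul_right {P : MvPolynomial σ ℂ} {d : ℕ} (hP : P.IsHomogeneous d)
    (Q R : MvPolynomial σ ℂ) :
    ∑ i, fischerForm (pderiv i R) (pderiv i P * Q) = d * fischerForm R (P * Q) := by
  simp_rw [← fischerForm_X_mul_right, ← mul_assoc]
  rw [← map_sum, ← sum_mul, hP.sum_X_mul_pderiv, smul_mul_assoc, map_nsmul, nsmul_eq_mul]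

lemma pderiv_pderiv_comm {σ R : Type*} [CommSemiring R] (i j : σ) (P : MvPolynomial σ R) :
    pderiv i (pderiv j P) = pderiv j (pderiv i P) := by
  obtain rfl | hij := eq_or_ne i j
  · rfl
  ext α
  simp only [coeff_pderiv, Finsupp.add_apply, Finsupp.single_eq_of_ne hij,
    Finsupp.single_eq_of_ne hij.symm, add_zero, add_right_comm α, mul_right_comm]

lemma exists_eq_C_of_isHomogeneous_zero {σ R : Type*} [CommSemiring R] {P : MvPolynomial σ R}
    (hP : P.IsHomogeneous 0) : ∃ c, P = C c :=
  ⟨_, totalDegree_eq_zero_iff_eq_C.1 ((totalDegree_zero_iff_isHomogeneous _).2 hP)⟩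

/-- The sum of `⟨P a * Q b, P b * Q a⟩` over all pairs `a, b`: the Fischer form of products with
the factors `Q` exchanged. -/
noncomputable def exchangeSum {κ : Type*} [Fintype κ] (P Q : κ → MvPolynomial σ ℂ) : ℂ :=
  ∑ a, ∑ b, fischerForm (P a * Q b) (P b * Q a)

/-- The variant of `exchangeSum` in which one factor on either side is differentiated; it is what
the Leibniz rule adds to `exchangeSum (∂P) Q`. -/
noncomputable def derivExchangeSum {κ : Type*} [Fintype κ] (P Q : κ → MvPolynomial σ ℂ) : ℂ :=
  ∑ a, ∑ b, ∑ i, fischerForm (pderiv i (P a) * Q b) (P b * pderiv i (Q a))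

lemma degree_mul_exchangeSum {κ : Type*} [Fintype κ] {P : κ → MvPolynomial σ ℂ} {d : ℕ}
    (hP : ∀ a, (P a).IsHomogeneous d) (Q : κ → MvPolynomial σ ℂ) :
    d * exchangeSum P Q =
      ∑ i, exchangeSum (fun a => pderiv i (P a)) Q + derivExchangeSum P Q := by
  have leibniz (a b : κ) : d * fischerForm (P a * Q b) (P b * Q a) =
      ∑ i, fischerForm (pderiv i (P a) * Q b) (pderiv i (P b) * Q a) +
        ∑ i, fischerForm (pderiv i (P a) * Q b) (P b * pderiv i (Q a)) := by
    simp only [← sum_fischerForm_pderiv_mul_left (hP a), pderiv_mul, map_add, sum_add_distrib]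
  simp only [exchangeSum, derivExchangeSum, mul_sum, leibniz, sum_add_distrib]
  rw [sum_comm_cycle]

lemma degree_mul_derivExchangeSum {κ : Type*} [Fintype κ] {P : κ → MvPolynomial σ ℂ} {d : ℕ}
    (hP : ∀ a, (P a).IsHomogeneous d) (Q : κ → MvPolynomial σ ℂ) :
    d * derivExchangeSum P Q =
      ∑ j, derivExchangeSum (fun a => pderiv j (P a)) Q +
        exchangeSum (fun x : κ × σ => pderiv x.2 (P x.1)) fun x => pderiv x.2 (Q x.1) := by
  have leibniz (a b : κ) :
      d * ∑ i, fischerForm (pderiv i (P a) * Q b) (P b * pderiv i (Q a)) =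
        ∑ j, ∑ i, fischerForm (pderiv i (pderiv j (P a)) * Q b)
            (pderiv j (P b) * pderiv i (Q a)) +
          ∑ i, ∑ j, fischerForm (pderiv i (P a) * pderiv j (Q b))
            (pderiv j (P b) * pderiv i (Q a)) := by
    rw [sum_comm, ← sum_add_distrib, mul_sum]
    refine sum_congr rfl fun i _ => ?_
    rw [← sum_fischerForm_pderiv_mul_right (hP b), ← sum_add_distrib]
    refine sum_congr rfl fun j _ => ?_
    rw [pderiv_mul, map_add, LinearMap.add_apply, pderiv_pderiv_comm j i]
  rw [derivExchangeSum]
  simp_rw [mul_sum (s := (univ : Finset κ)), leibniz, sum_add_distrib]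
  rw [sum_comm_cycle]
  simp_rw [exchangeSum, Fintype.sum_prod_type]
  exact congrArg _ (sum_congr rfl fun a _ => sum_comm)

/- Allowing families rather than single polynomials is what makes this induction close: the degree
recursion for `derivExchangeSum` enlarges the index type by the set of variables. -/
lemma exchangeSum_nonneg_and_derivExchangeSum_nonneg {d : ℕ} {κ : Type u} [Fintype κ]
    {P : κ → MvPolynomial σ ℂ} (hP : ∀ a, (P a).IsHomogeneous d) (Q : κ → MvPolynomial σ ℂ) :
    0 ≤ exchangeSum P Q ∧ 0 ≤ derivExchangeSum P Q := by
  induction d generalizing κ with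
  | zero =>
    choose c hc using fun a => exists_eq_C_of_isHomogeneous_zero (hP a)
    constructor
    · have isSquare : exchangeSum P Q =
          fischerForm (∑ b, star (c b) • Q b) (∑ a, star (c a) • Q a) := by
        simp only [exchangeSum, hc, C_mul', map_sum, LinearMap.sum_apply, map_smul,
          LinearMap.map_smulₛₗ, LinearMap.smul_apply, Complex.star_def, Complex.conj_conj,
          smul_sum, smul_comm (c _)]
      rw [isSquare]
      exact fischerForm_self_nonneg _
    · simp only [derivExchangeSum, hc, pderiv_C, zero_mul, map_zero, LinearMap.zero_apply,
        sum_const_zero, le_refl]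
  | succ d ih =>
    have deriv_homogeneous (i : σ) (a : κ) : (pderiv i (P a)).IsHomogeneous d := (hP a).pderiv
    have degree_pos : (0 : ℂ) < (d + 1 : ℕ) := Nat.cast_pos.2 d.succ_pos
    have deriv_nonneg : 0 ≤ derivExchangeSum P Q := by
      refine le_of_mul_le_mul_left ?_ degree_pos
      rw [mul_zero, degree_mul_derivExchangeSum hP]
      exact add_nonneg (sum_nonneg fun j _ => (ih (deriv_homogeneous j) Q).2)
        (ih (fun x : κ × σ => deriv_homogeneous x.2 x.1) _).1
    refine ⟨le_of_mul_le_mul_left ?_ degree_pos, deriv_nonneg⟩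
    rw [mul_zero, degree_mul_exchangeSum hP]
    exact add_nonneg (sum_nonneg fun i _ => (ih (deriv_homogeneous i) Q).1) deriv_nonneg

theorem fischerForm_self_mul_le {P : MvPolynomial σ ℂ} {d : ℕ} (hP : P.IsHomogeneous d)
    (Q : MvPolynomial σ ℂ) :
    fischerForm P P * fischerForm Q Q ≤ fischerForm (P * Q) (P * Q) := by
  induction d generalizing P with
  | zero =>
    obtain ⟨c, rfl⟩ := exists_eq_C_of_isHomogeneous_zero hP
    have hC : (C c : MvPolynomial σ ℂ) = c • 1 := by rw [smul_eq_C_mul, mul_one]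
    simp only [hC, smul_mul_assoc, one_mul, map_smul, LinearMap.map_smulₛₗ, LinearMap.smul_apply,
      fischerForm_one_one, smul_eq_mul, mul_one, mul_assoc, le_refl]
  | succ d ih =>
    refine le_of_mul_le_mul_left ?_ (Nat.cast_pos.2 d.succ_pos : (0 : ℂ) < (d + 1 : ℕ))
    have recursion := degree_mul_exchangeSum (κ := PUnit) (fun _ => hP) fun _ => Q
    simp only [exchangeSum, univ_unique, sum_singleton] at recursion
    calc _ = ∑ i, fischerForm (pderiv i P) (pderiv i P) * fischerForm Q Q := by
          have euler := sum_fischerForm_pderiv_mul_left hP 1 P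
          simp only [mul_one] at euler
          rw [← mul_assoc, ← euler, sum_mul]
      _ ≤ ∑ i, fischerForm (pderiv i P * Q) (pderiv i P * Q) :=
          sum_le_sum fun i _ => ih hP.pderiv
      _ ≤ _ := by
          rw [recursion]
          exact le_add_of_nonneg_right
            (exchangeSum_nonneg_and_derivExchangeSum_nonneg (κ := PUnit) (fun _ => hP) _).2

theorem prod_fischerForm_self_le {ι : Type*} (s : Finset ι) {P : ι → MvPolynomial σ ℂ} {d : ι → ℕ}
    (hP : ∀ i ∈ s, (P i).IsHomogeneous (d i)) :
    ∏ i ∈ s, fischerForm (P i) (P i) ≤ fischerForm (∏ i ∈ s, P i) (∏ i ∈ s, P i) := by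
  classical
  induction s using Finset.induction with
  | empty => simp only [prod_empty, fischerForm_one_one, le_refl]
  | insert a s ha ih =>
    rw [prod_insert ha, prod_insert ha]
    exact (mul_le_mul_of_nonneg_left (ih fun i hi => hP i (mem_insert_of_mem hi))
      (fischerForm_self_nonneg _)).trans (fischerForm_self_mul_le (hP a (mem_insert_self a s)) _)

end Fischer

section Haar

/-- The monomial `star z ^ a * z ^ b` weighted by the (unnormalized) Gaussian density of `ℂ`. -/
noncomputable def gaussMonomial (a b : ℕ) (z : ℂ) : ℂ :=
  star z ^ a * z ^ b * (Real.exp (-‖z‖ ^ 2) : ℝ)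

lemma integrable_gaussMonomial (a b : ℕ) : Integrable (gaussMonomial a b) := by
  have integrable_radial : Integrable fun z : ℂ => ‖z‖ ^ (a + b) * Real.exp (-‖z‖ ^ 2) := by
    rw [integrable_fun_norm_addHaar (μ := (volume : Measure ℂ))
      (f := fun y : ℝ => y ^ (a + b) * Real.exp (-y ^ 2))]
    have := integrableOn_rpow_mul_exp_neg_mul_sq (b := 1) one_pos (s := (1 + (a + b) : ℕ))
      (neg_one_lt_zero.trans_le (Nat.cast_nonneg _))
    refine this.congr_fun (fun y _ => ?_) measurableSet_Ioi
    simp only [Real.rpow_natCast, Complex.finrank_real_complex, smul_eq_mul]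
    ring_nf
  refine integrable_radial.mono' (by unfold gaussMonomial; fun_prop) (.of_forall fun z => ?_)
  simp only [gaussMonomial, norm_mul, norm_pow, norm_star, Complex.norm_real, Real.norm_eq_abs,
    Real.abs_exp, pow_add, le_refl]

lemma gaussMonomial_rotation (a b : ℕ) (c : Circle) (z : ℂ) :
    gaussMonomial a b (rotation c z) = star (c : ℂ) ^ a * (c : ℂ) ^ b * gaussMonomial a b z := by
  simp only [gaussMonomial, rotation_apply, norm_mul, Circle.norm_coe, one_mul, star_mul']
  ring

lemma exists_circle_star_pow_mul_pow_ne_one {a b : ℕ} (h : a ≠ b) :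
    ∃ c : Circle, star (c : ℂ) ^ a * (c : ℂ) ^ b ≠ 1 := by
  have hba : (b : ℂ) - a ≠ 0 := sub_ne_zero.2 (Nat.cast_injective.ne h.symm)
  refine ⟨Circle.exp (Real.pi / (b - a)), ?_⟩
  rw [Circle.coe_exp, Complex.star_def, ← Complex.exp_conj, ← Complex.exp_nat_mul,
    ← Complex.exp_nat_mul, ← Complex.exp_add, map_mul, Complex.conj_I, Complex.conj_ofReal]
  have angle : (a : ℂ) * (((Real.pi / (b - a) : ℝ) : ℂ) * -Complex.I) +
      b * (((Real.pi / (b - a) : ℝ) : ℂ) * Complex.I) = Real.pi * Complex.I := by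
    push_cast
    field_simp
    ring
  rw [angle, Complex.exp_pi_mul_I]
  norm_num

lemma integral_gaussMonomial_of_ne {a b : ℕ} (h : a ≠ b) : ∫ z, gaussMonomial a b z = 0 := by
  obtain ⟨c, hc⟩ := exists_circle_star_pow_mul_pow_ne_one h
  have invariant : ∫ z, gaussMonomial a b (rotation c z) = ∫ z, gaussMonomial a b z :=
    (rotation c).measurePreserving.integral_comp
      (rotation c).toMeasurableEquiv.measurableEmbedding _
  simp_rw [gaussMonomial_rotation, integral_const_mul] at invariant
  exact (mul_left_eq_self₀.1 invariant).resolve_left hc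

lemma integral_gaussMonomial_self (a : ℕ) :
    ∫ z, gaussMonomial a a z = Real.pi * a.factorial := by
  have moment := Complex.integral_rpow_mul_exp_neg_rpow (p := 2) (q := (2 * a : ℕ)) one_le_two
    ((by norm_num : (-2 : ℝ) < 0).trans_le (Nat.cast_nonneg _))
  rw [show ((2 * a : ℕ) + 2 : ℝ) / 2 = a + 1 by push_cast; ring, Real.Gamma_nat_eq_factorial,
    mul_div_cancel_left₀ _ two_ne_zero] at moment
  rw [← Complex.ofReal_natCast, ← Complex.ofReal_mul, ← moment, ← integral_complex_ofReal]
  refine integral_congr_ae (.of_forall fun z => ?_)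
  simp only [gaussMonomial, ← mul_pow, Complex.star_def, Complex.conj_mul', Real.rpow_natCast,
    Real.rpow_two, pow_mul, Complex.ofReal_mul, Complex.ofReal_pow]

variable {ι : Type*} [Fintype ι]

lemma integral_prod_gaussMonomial (α β : ι →₀ ℕ) :
    ∫ z : ι → ℂ, ∏ i, gaussMonomial (α i) (β i) (z i) =
      if α = β then (Real.pi : ℂ) ^ Fintype.card ι * ∏ i, ((α i).factorial : ℂ) else 0 := by
  rw [integral_fintype_prod_volume_eq_prod]
  split_ifs with h
  · simp only [h, integral_gaussMonomial_self, prod_mul_distrib, prod_const, card_univ]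
  · obtain ⟨i, hi⟩ := DFunLike.ne_iff.1 h
    exact prod_eq_zero (mem_univ i) (integral_gaussMonomial_of_ne hi)

lemma integral_star_eval_mul_eval_mul_exp (P Q : MvPolynomial ι ℂ) :
    ∫ z : ι → ℂ, star (eval z P) * eval z Q * (Real.exp (-∑ i, ‖z i‖ ^ 2) : ℝ) =
      Real.pi ^ Fintype.card ι * fischerForm P Q := by
  have expand (z : ι → ℂ) :
      star (eval z P) * eval z Q * (Real.exp (-∑ i, ‖z i‖ ^ 2) : ℝ) =
        ∑ α ∈ P.support, ∑ β ∈ Q.support, star (P.coeff α) * Q.coeff β *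
          ∏ i, gaussMonomial (α i) (β i) (z i) := by
    rw [eval_eq', eval_eq', star_sum, sum_mul_sum]
    simp only [gaussMonomial, prod_mul_distrib, star_mul', star_prod, star_pow, sum_mul,
      ← sum_neg_distrib, Real.exp_sum, Complex.ofReal_prod]
    exact sum_congr rfl fun α _ => sum_congr rfl fun β _ => by ring
  have integrable_term (α β : ι →₀ ℕ) :
      Integrable fun z : ι → ℂ => ∏ i, gaussMonomial (α i) (β i) (z i) :=
    Integrable.fintype_prod fun i => integrable_gaussMonomial _ _
  simp_rw [expand]
  rw [integral_finsetSum _ fun α _ =>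
    integrable_finsetSum _ fun β _ => (integrable_term α β).const_mul _, fischerForm_apply, mul_sum]
  refine sum_congr rfl fun α _ => ?_
  rw [integral_finsetSum _ fun β _ => (integrable_term α β).const_mul _]
  simp_rw [integral_const_mul, integral_prod_gaussMonomial, mul_ite, mul_zero]
  rw [sum_ite_eq]
  split_ifs with h
  · ring
  · rw [notMem_support_iff.1 h]
    ring

lemma eval_smul_of_isHomogeneous {σ R : Type*} [CommSemiring R] {P : MvPolynomial σ R} {d : ℕ}
    (hP : P.IsHomogeneous d) (r : R) (z : σ → R) : eval (r • z) P = r ^ d * eval z P := by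
  rw [eval_eq, eval_eq, mul_sum]
  refine sum_congr rfl fun α hα => ?_
  simp only [Pi.smul_apply, smul_eq_mul, mul_pow, prod_mul_distrib]
  rw [prod_pow_eq_pow_sum, ← hP.degree_eq_sum_deg_support hα, mul_left_comm]

lemma exists_integral_comp_ofLp (ι : Type*) [Fintype ι] : ∃ c : ℂ, ∀ f : (ι → ℂ) → ℂ,
    ∫ z : EuclideanSpace ℂ ι, f z.ofLp = c * ∫ z, f z := by
  let e := PiLp.continuousLinearEquiv 2 ℝ (fun _ : ι => ℂ)
  have : (Measure.map e (volume : Measure (EuclideanSpace ℂ ι))).IsAddHaarMeasure :=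
    e.isAddHaarMeasure_map _
  refine ⟨((Measure.map e volume).addHaarScalarFactor volume : ℝ), fun f => ?_⟩
  calc _ = ∫ z, f z ∂(Measure.map e volume) :=
        (e.toHomeomorph.measurableEmbedding.integral_map f).symm
    _ = _ := by
      conv_lhs => rw [Measure.isAddLeftInvariant_eq_smul (Measure.map e volume) volume]
      rw [integral_smul_nnreal_measure]
      rfl

lemma integral_mul_fun_norm_addHaar_of_homogeneous {E 𝕜 : Type*} [RCLike 𝕜]
    [NormedAddCommGroup E] [NormedSpace ℝ E] [Nontrivial E] [FiniteDimensional ℝ E]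
    [MeasurableSpace E] [BorelSpace E] (μ : Measure E) [μ.IsAddHaarMeasure] {f : E → 𝕜} {k : ℕ}
    (hf : ∀ r : ℝ, 0 < r → ∀ x, f (r • x) = r ^ k • f x) (g : ℝ → 𝕜) :
    ∫ x, f x * g ‖x‖ ∂μ =
      (∫ x, f x ∂μ.toSphere) * ∫ r in Set.Ioi (0 : ℝ), r ^ (Module.finrank ℝ E - 1 + k) • g r := by
  have polar (x : ({0}ᶜ : Set E)) : f x * g ‖x.1‖ =
      f (homeomorphUnitSphereProd E x).1 *
        ((homeomorphUnitSphereProd E x).2.1 ^ k • g (homeomorphUnitSphereProd E x).2) := by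
    have norm_pos : 0 < ‖x.1‖ := norm_pos_iff.2 x.2
    have := hf ‖x.1‖ norm_pos (‖x.1‖⁻¹ • x.1)
    rw [smul_inv_smul₀ norm_pos.ne'] at this
    simp only [homeomorphUnitSphereProd_apply_fst_coe, homeomorphUnitSphereProd_apply_snd_coe]
    rw [this, smul_mul_assoc, mul_smul_comm]
  calc
    _ = ∫ x : ({0}ᶜ : Set E), f x * g ‖x.1‖ ∂(μ.comap (↑)) := by
      rw [integral_subtype_comap (measurableSet_singleton _).compl fun x => f x * g ‖x‖,
        restrict_compl_singleton]
    _ = ∫ x, f x.1 * (x.2.1 ^ k • g x.2)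
          ∂μ.toSphere.prod (.volumeIoiPow (Module.finrank ℝ E - 1)) := by
      simp_rw [polar]
      exact μ.measurePreserving_homeomorphUnitSphereProd.integral_comp
        (Homeomorph.measurableEmbedding _) fun x => f x.1 * (x.2.1 ^ k • g x.2)
    _ = (∫ x, f x ∂μ.toSphere) *
          ∫ r : Set.Ioi (0 : ℝ), r.1 ^ k • g r ∂.volumeIoiPow (Module.finrank ℝ E - 1) :=
      integral_prod_mul (fun x : Metric.sphere (0 : E) 1 => f x) fun r : Set.Ioi (0 : ℝ) =>
        r.1 ^ k • g r
    _ = _ := by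
      simp only [Measure.volumeIoiPow, ENNReal.ofReal]
      rw [integral_withDensity_eq_integral_smul
          (measurable_subtype_coe.pow_const _).real_toNNReal,
        integral_subtype_comap measurableSet_Ioi fun r : ℝ =>
          Real.toNNReal (r ^ (Module.finrank ℝ E - 1)) • r ^ k • g r,
        setIntegral_congr_fun measurableSet_Ioi fun r hr => ?_]
      rw [NNReal.smul_def, Real.coe_toNNReal _ (pow_nonneg hr.out.le _), smul_smul, pow_add]

lemma integral_pow_smul_exp_neg_sq (k : ℕ) :
    ∫ r in Set.Ioi (0 : ℝ), r ^ (2 * k + 1) • (Real.exp (-r ^ 2) : ℂ) = k.factorial / 2 := by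
  have moment := integral_rpow_mul_exp_neg_rpow (p := 2) (q := (2 * k + 1 : ℕ)) two_pos
    (neg_one_lt_zero.trans_le (Nat.cast_nonneg _))
  rw [show (((2 * k + 1 : ℕ) : ℝ) + 1) / 2 = k + 1 by push_cast; ring,
    Real.Gamma_nat_eq_factorial] at moment
  simp_rw [Real.rpow_natCast, Real.rpow_two] at moment
  simp_rw [Complex.real_smul, ← Complex.ofReal_mul]
  rw [integral_complex_ofReal, moment]
  push_cast
  ring

lemma exists_integral_toSphere_mul_factorial (ι : Type*) [Fintype ι] [Nonempty ι] :
    ∃ c : ℂ, ∀ (d : ℕ) (P Q : MvPolynomial ι ℂ), P.IsHomogeneous d → Q.IsHomogeneous d →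
      (∫ z, star (eval z.1.ofLp P) * eval z.1.ofLp Q
        ∂(volume : Measure (EuclideanSpace ℂ ι)).toSphere) * (Fintype.card ι - 1 + d).factorial =
          c * fischerForm P Q := by
  obtain ⟨c, hc⟩ := exists_integral_comp_ofLp ι
  refine ⟨2 * (c * Real.pi ^ Fintype.card ι), fun d P Q hP hQ => ?_⟩
  have homogeneous (r : ℝ) (_ : 0 < r) (z : EuclideanSpace ℂ ι) :
      star (eval (r • z).ofLp P) * eval (r • z).ofLp Q =
        r ^ (2 * d) • (star (eval z.ofLp P) * eval z.ofLp Q) := by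
    have smul_eq : (r • z).ofLp = (r : ℂ) • z.ofLp := rfl
    simp only [smul_eq, eval_smul_of_isHomogeneous hP, eval_smul_of_isHomogeneous hQ, star_mul',
      star_pow, Complex.star_def, Complex.conj_ofReal, Complex.real_smul, Complex.ofReal_pow]
    ring
  have exponent : Module.finrank ℝ (EuclideanSpace ℂ ι) - 1 + 2 * d =
      2 * (Fintype.card ι - 1 + d) + 1 := by
    rw [← Module.finrank_mul_finrank ℝ ℂ, Complex.finrank_real_complex, finrank_euclideanSpace]
    have := Fintype.card_pos (α := ι)
    omega
  have gaussian_polar := integral_mul_fun_norm_addHaar_of_homogeneous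
    (volume : Measure (EuclideanSpace ℂ ι)) (f := fun z => star (eval z.ofLp P) * eval z.ofLp Q)
    homogeneous fun r => (Real.exp (-r ^ 2) : ℂ)
  have gaussian_cartesian := hc fun z =>
    star (eval z P) * eval z Q * (Real.exp (-∑ i, ‖z i‖ ^ 2) : ℝ)
  rw [integral_star_eval_mul_eval_mul_exp] at gaussian_cartesian
  simp_rw [EuclideanSpace.norm_sq_eq] at gaussian_polar
  rw [gaussian_cartesian, exponent, integral_pow_smul_exp_neg_sq] at gaussian_polar
  linear_combination -2 * gaussian_polar

theorem average_toSphere_mul_ascFactorial [Nonempty ι] {P Q : MvPolynomial ι ℂ} {d : ℕ}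
    (hP : P.IsHomogeneous d) (hQ : Q.IsHomogeneous d) :
    (⨍ z, star (eval z.1.ofLp P) * eval z.1.ofLp Q
        ∂(volume : Measure (EuclideanSpace ℂ ι)).toSphere) * (Fintype.card ι).ascFactorial d =
      fischerForm P Q := by
  obtain ⟨c, hc⟩ := exists_integral_toSphere_mul_factorial ι
  have total_mass := hc 0 1 1 (isHomogeneous_one _ _) (isHomogeneous_one _ _)
  simp only [map_one, star_one, integral_const, fischerForm_one_one, add_zero, mul_one,
    Complex.real_smul] at total_mass
  have mass_ne_zero : (volume : Measure (EuclideanSpace ℂ ι)).toSphere.real Set.univ ≠ 0 :=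
    (measureReal_ne_zero_iff).2 (Measure.measure_univ_ne_zero.2 (Measure.toSphere_ne_zero _))
  have factorial_eq := Nat.factorial_mul_ascFactorial (Fintype.card ι - 1) d
  rw [Nat.sub_add_cancel Fintype.card_pos] at factorial_eq
  have moment := hc d P Q hP hQ
  rw [← factorial_eq, ← total_mass, ← measure_smul_average, Complex.real_smul,
    Nat.cast_mul] at moment
  refine mul_left_cancel₀ (mul_ne_zero (Complex.ofReal_ne_zero.2 mass_ne_zero)
    (Nat.cast_ne_zero.2 (Fintype.card ι - 1).factorial_ne_zero)) ?_
  linear_combination moment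

end Haar

section Tensor

variable {ι : Type} [Fintype ι] {R S T : ι → Type}

/-- The product vector with factors `v i`, in the product basis used by `tensor`. -/
def tensorVec (v : ∀ i, R i → ℂ) : (∀ i, R i) → ℂ :=
  fun a => ∏ i, v i (a i)

lemma star_tensorVec (v : ∀ i, R i → ℂ) : star (tensorVec v) = tensorVec fun i => star (v i) := by
  ext a
  simp only [tensorVec, Pi.star_apply, star_prod]

lemma tensor_vecMulVec (u : ∀ i, S i → ℂ) (v : ∀ i, R i → ℂ) :
    tensor (fun i => vecMulVec (u i) (v i)) = vecMulVec (tensorVec u) (tensorVec v) := by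
  ext a b
  simp only [tensor, tensorVec, vecMulVec_apply, of_apply, prod_mul_distrib]

lemma conjTranspose_tensor (K : ∀ i, Matrix (S i) (R i) ℂ) :
    (tensor K)ᴴ = tensor fun i => (K i)ᴴ := by
  ext a b
  simp only [tensor, conjTranspose_apply, of_apply, star_prod]

lemma tensor_one [∀ i, DecidableEq (R i)] :
    tensor (fun i => (1 : Matrix (R i) (R i) ℂ)) = 1 := by
  ext a b
  simp only [tensor, of_apply, one_apply, Fintype.prod_ite_zero, prod_const_one, funext_iff]

variable [DecidableEq ι]

lemma tensor_mul [∀ i, Fintype (S i)] (K : ∀ i, Matrix (T i) (S i) ℂ)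
    (L : ∀ i, Matrix (S i) (R i) ℂ) : tensor K * tensor L = tensor fun i => K i * L i := by
  ext a b
  simp only [tensor, Matrix.mul_apply, of_apply, ← prod_mul_distrib]
  exact (Fintype.prod_sum fun i c => K i (a i) c * L i c (b i)).symm

lemma tensor_mulVec_tensorVec [∀ i, Fintype (R i)] (K : ∀ i, Matrix (S i) (R i) ℂ)
    (v : ∀ i, R i → ℂ) : tensor K *ᵥ tensorVec v = tensorVec fun i => K i *ᵥ v i := by
  ext a
  simp only [tensor, tensorVec, mulVec, dotProduct, of_apply, ← prod_mul_distrib]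
  exact (Fintype.prod_sum fun i c => K i (a i) c * v i c).symm

lemma tensorVec_dotProduct_tensorVec [∀ i, Fintype (R i)] (u v : ∀ i, R i → ℂ) :
    tensorVec u ⬝ᵥ tensorVec v = ∏ i, u i ⬝ᵥ v i := by
  simp only [tensorVec, dotProduct, ← prod_mul_distrib]
  exact (Fintype.prod_sum fun i c => u i c * v i c).symm

lemma trace_tensor [∀ i, Fintype (R i)] (K : ∀ i, Matrix (R i) (R i) ℂ) :
    (tensor K).trace = ∏ i, (K i).trace :=
  (Fintype.prod_sum fun i c => K i c c).symm

lemma sum_tensor {κ : ι → Type} [∀ i, Fintype (κ i)] (K : ∀ i, κ i → Matrix (S i) (R i) ℂ) :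
    ∑ k : ∀ i, κ i, tensor (fun i => K i (k i)) = tensor fun i => ∑ k, K i k := by
  ext a b
  simp only [tensor, Matrix.sum_apply, of_apply]
  exact (Fintype.prod_sum fun i c => K i c (a i) (b i)).symm

end Tensor

section LOCC

variable {m : ℕ} {R S Ω : Fin m → Type} [∀ i, Fintype (R i)] [∀ i, DecidableEq (R i)]
  [∀ i, Fintype (S i)] [∀ i, Fintype (Ω i)]

/-- Nonnegativity of the quadratic form of `X` on all product vectors. This is weaker than positive
semidefiniteness, but it is all that local operations and classical communication can detect. -/
def IsBlockPositive {ι : Type} [Fintype ι] [DecidableEq ι] {R : ι → Type} [∀ i, Fintype (R i)]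
    (X : Matrix (∀ i, R i) (∀ i, R i) ℂ) : Prop :=
  ∀ v : ∀ i, R i → ℂ, 0 ≤ star (tensorVec v) ⬝ᵥ (X *ᵥ tensorVec v)

lemma IsBlockPositive.trace_nonneg {ι : Type} [Fintype ι] [DecidableEq ι] {R : ι → Type}
    [∀ i, Fintype (R i)] {X : Matrix (∀ i, R i) (∀ i, R i) ℂ} (hX : IsBlockPositive X) :
    0 ≤ X.trace := by
  classical
  refine sum_nonneg fun a _ => ?_
  have basis : tensorVec (fun i => Pi.single (a i) 1) = Pi.single a (1 : ℂ) := by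
    ext b
    simp only [tensorVec, Pi.single_apply, Fintype.prod_ite_zero, prod_const_one, funext_iff]
  have := hX fun i => Pi.single (a i) 1
  rwa [basis, ← Pi.single_star, star_one, mulVec_single_one, single_one_dotProduct] at this

lemma IsBlockPositive.postState {X : Matrix (∀ i, R i) (∀ i, R i) ℂ} (hX : IsBlockPositive X)
    (I : ∀ i, Instrument (R i) (S i) (Ω i)) (w : ∀ i, Ω i) :
    IsBlockPositive (postState I w X) := by
  intro v
  rw [HaarLOCC.postState, sum_mulVec, dotProduct_sum]
  refine sum_nonneg fun k _ => ?_
  have pullback := hX fun i => ((I i).K (w i) (k i))ᴴ *ᵥ v i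
  rwa [← tensor_mulVec_tensorVec, ← conjTranspose_tensor, star_mulVec, conjTranspose_conjTranspose,
    ← dotProduct_mulVec, mulVec_mulVec, mulVec_mulVec] at pullback

lemma postState_add_smul (I : ∀ i, Instrument (R i) (S i) (Ω i)) (w : ∀ i, Ω i) (c : ℝ)
    (X Y : Matrix (∀ i, R i) (∀ i, R i) ℂ) :
    postState I w (X + c • Y) = postState I w X + c • postState I w Y := by
  simp only [postState, Matrix.mul_add, Matrix.add_mul, Matrix.mul_smul, Matrix.smul_mul,
    sum_add_distrib, smul_sum]

lemma sum_trace_postState (I : ∀ i, Instrument (R i) (S i) (Ω i))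
    (X : Matrix (∀ i, R i) (∀ i, R i) ℂ) : ∑ w, (postState I w X).trace = X.trace := by
  have complete : ∑ w : ∀ i, Ω i, ∑ k : ∀ i, Fin (I i).rank,
      (tensor fun i => (I i).K (w i) (k i))ᴴ * (tensor fun i => (I i).K (w i) (k i)) = 1 := by
    simp_rw [conjTranspose_tensor, tensor_mul]
    rw [sum_congr rfl fun w _ => sum_tensor fun i k => ((I i).K (w i) k)ᴴ * (I i).K (w i) k,
      sum_tensor fun i w => ∑ k, ((I i).K w k)ᴴ * (I i).K w k]
    simp_rw [(I _).complete, tensor_one]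
  calc _ = ∑ w : ∀ i, Ω i, ∑ k : ∀ i, Fin (I i).rank,
        ((tensor fun i => (I i).K (w i) (k i))ᴴ * (tensor fun i => (I i).K (w i) (k i)) *
          X).trace := by
        simp only [postState, trace_sum]
        refine sum_congr rfl fun w _ => sum_congr rfl fun k _ => ?_
        rw [Matrix.trace_mul_comm, Matrix.mul_assoc]
    _ = _ := by
        simp only [← trace_sum, ← Matrix.sum_mul]
        rw [complete, Matrix.one_mul]

namespace Protocol

lemma prob_add_smul (P : Protocol m R) (c : ℝ) (X Y : Matrix (∀ i, R i) (∀ i, R i) ℂ) :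
    P.prob (X + c • Y) = P.prob X + c * P.prob Y := by
  induction P with
  | output b => cases b <;> simp [prob]
  | round S Ω I next ih =>
    simp only [prob, postState_add_smul, ih, sum_add_distrib, mul_sum]

lemma prob_mem_Icc (P : Protocol m R) {X : Matrix (∀ i, R i) (∀ i, R i) ℂ}
    (hX : IsBlockPositive X) : P.prob X ∈ Set.Icc 0 X.trace.re := by
  induction P with
  | output b =>
    have trace_re_nonneg : 0 ≤ X.trace.re := (Complex.le_def.1 hX.trace_nonneg).1
    cases b with
    | false => exact ⟨le_rfl, trace_re_nonneg⟩
    | true => exact ⟨trace_re_nonneg, le_rfl⟩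
  | round S Ω I next ih =>
    rw [← sum_trace_postState I, Complex.re_sum]
    exact ⟨sum_nonneg fun w _ => (ih w (hX.postState I w)).1,
      sum_le_sum fun w _ => (ih w (hX.postState I w)).2⟩

end Protocol

theorem loccIndistinguishable_of_isBlockPositive {ε : ℝ}
    {ρ σ : Matrix (∀ i, R i) (∀ i, R i) ℂ} (hρ : ρ.trace = 1) (hσ : σ.trace = 1)
    (hσ_pos : IsBlockPositive σ) (hρσ : IsBlockPositive (ρ - (1 - ε) • σ)) :
    LOCCIndistinguishable ε ρ σ := by
  intro P
  obtain ⟨diff_nonneg, diff_le⟩ := P.prob_mem_Icc hρσ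
  obtain ⟨σ_nonneg, σ_le⟩ := P.prob_mem_Icc hσ_pos
  have decomposition := P.prob_add_smul (1 - ε) (ρ - (1 - ε) • σ) σ
  rw [sub_add_cancel] at decomposition
  rw [trace_sub, trace_smul, hρ, hσ, Complex.sub_re, Complex.smul_re, Complex.one_re, smul_eq_mul,
    mul_one, sub_sub_cancel] at diff_le
  rw [hσ, Complex.one_re] at σ_le
  rw [decomposition, abs_le]
  constructor <;> nlinarith

end LOCC

section EntrywiseIntegral

variable {Ω A B : Type*} [Fintype A] [Fintype B] [MeasurableSpace Ω] {μ : Measure Ω}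

lemma dotProduct_integral_mulVec {M : Ω → Matrix A B ℂ}
    (hM : ∀ a b, Integrable (fun ω => M ω a b) μ) (x : A → ℂ) (y : B → ℂ) :
    x ⬝ᵥ ((of fun a b => ∫ ω, M ω a b ∂μ) *ᵥ y) = ∫ ω, x ⬝ᵥ (M ω *ᵥ y) ∂μ := by
  simp only [mulVec, dotProduct, of_apply, mul_sum]
  have integrable : ∀ a b, Integrable (fun ω => x a * (M ω a b * y b)) μ :=
    fun a b => ((hM a b).mul_const _).const_mul _
  rw [integral_finsetSum _ fun a _ => integrable_finsetSum _ fun b _ => integrable a b]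
  refine sum_congr rfl fun a _ => ?_
  rw [integral_finsetSum _ fun b _ => integrable a b]
  simp only [integral_const_mul, integral_mul_const]

lemma trace_integral {M : Ω → Matrix A A ℂ} (hM : ∀ a, Integrable (fun ω => M ω a a) μ) :
    (of fun a b => ∫ ω, M ω a b ∂μ).trace = ∫ ω, (M ω).trace ∂μ :=
  (integral_finsetSum _ fun a _ => hM a).symm

end EntrywiseIntegral

section HaarState

variable {n : ℕ}

lemma integrable_haarState_of_continuous {E : Type*} [NormedAddCommGroup E] {f : QubitSpace n → E}
    (hf : Continuous f) :
    Integrable (fun ψ : Metric.sphere (0 : QubitSpace n) 1 => f ψ) (haarState n) :=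
  (hf.comp continuous_subtype_val).integrable_of_hasCompactSupport
    (HasCompactSupport.of_compactSpace _)

lemma integral_haarState_mul_ascFactorial {d : ℕ} {P Q : MvPolynomial (Bits n) ℂ}
    (hP : P.IsHomogeneous d) (hQ : Q.IsHomogeneous d) :
    (∫ ψ, star (eval ψ.1.ofLp P) * eval ψ.1.ofLp Q ∂haarState n) * (2 ^ n).ascFactorial d =
      fischerForm P Q := by
  have := average_toSphere_mul_ascFactorial hP hQ
  rwa [Fintype.card_fun, Fintype.card_bool, Fintype.card_fin] at this

lemma continuous_copies_apply (t : ℕ) (a b : Fin t → Bits n) :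
    Continuous fun v : QubitSpace n => copies t v a b := by
  simp only [copies, tensor, ketbra, of_apply, vecMulVec_apply]
  fun_prop

lemma continuous_tensor_copies_apply (m t : ℕ) (a b : ∀ i, PartyReg m n t i) :
    Continuous fun v : QubitSpace n => tensor (fun _ : Fin m => copies t v) a b :=
  continuous_finsetProd univ fun i _ => continuous_copies_apply t (a i) (b i)

lemma copies_eq_vecMulVec (t : ℕ) (v : QubitSpace n) :
    copies t v = vecMulVec (tensorVec fun _ : Fin t => v.ofLp)
      (star (tensorVec fun _ : Fin t => v.ofLp)) := by
  rw [star_tensorVec]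
  exact tensor_vecMulVec _ _

lemma tensor_copies_eq_vecMulVec (m t : ℕ) (v : QubitSpace n) :
    tensor (fun _ : Fin m => copies t v) =
      vecMulVec (tensorVec fun _ : Fin m => tensorVec fun _ : Fin t => v.ofLp)
        (star (tensorVec fun _ : Fin m => tensorVec fun _ : Fin t => v.ofLp)) := by
  rw [star_tensorVec, ← tensor_vecMulVec]
  simp only [copies_eq_vecMulVec]

lemma trace_copies (t : ℕ) (ψ : Metric.sphere (0 : QubitSpace n) 1) :
    (copies t ψ.1).trace = 1 := by
  have trace_ketbra : (ketbra ψ.1).trace = 1 := by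
    rw [ketbra, trace_vecMulVec]
    exact (EuclideanSpace.inner_eq_star_dotProduct _ _).symm.trans
      (inner_self_eq_one_of_norm_eq_one (norm_eq_of_mem_sphere ψ))
  rw [copies, trace_tensor, prod_eq_one fun _ _ => trace_ketbra]

lemma trace_haarCopies (n t : ℕ) : (haarCopies n t).trace = 1 := by
  rw [haarCopies,
    trace_integral fun a => integrable_haarState_of_continuous (continuous_copies_apply t a a)]
  simp only [trace_copies, integral_const, probReal_univ, one_smul]

lemma trace_independentState (m n t : ℕ) : (independentState m n t).trace = 1 := by
  rw [independentState, trace_tensor, prod_eq_one fun _ _ => trace_haarCopies n t]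

lemma trace_sharedState (m n t : ℕ) : (sharedState m n t).trace = 1 := by
  rw [sharedState, trace_integral fun a =>
    integrable_haarState_of_continuous (continuous_tensor_copies_apply m t a a)]
  simp only [trace_tensor, trace_copies, prod_const_one, integral_const, probReal_univ, one_smul]

end HaarState

section QuadraticForms

/-- The polynomial `z ↦ ⟨x, z ⊗ ⋯ ⊗ z⟩` in the coordinates of a vector `z`: the amplitude of `t`
copies of `z` along `x`. -/
noncomputable def amplitudePoly {ι : Type*} [Fintype ι] {t : ℕ} (x : (Fin t → ι) → ℂ) :
    MvPolynomial ι ℂ :=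
  ∑ a, C (star (x a)) * ∏ j, X (a j)

lemma isHomogeneous_amplitudePoly {ι : Type*} [Fintype ι] {t : ℕ} (x : (Fin t → ι) → ℂ) :
    (amplitudePoly x).IsHomogeneous t := by
  refine IsHomogeneous.sum _ _ _ fun a _ => ?_
  have monomial_homogeneous := IsHomogeneous.prod univ (fun j => X (R := ℂ) (a j)) (fun _ => 1)
    fun j _ => isHomogeneous_X _ _
  rw [sum_const, card_univ, Fintype.card_fin, smul_eq_mul, mul_one] at monomial_homogeneous
  exact monomial_homogeneous.C_mul _

lemma eval_amplitudePoly {ι : Type} [Fintype ι] {t : ℕ} (x : (Fin t → ι) → ℂ) (z : ι → ℂ) :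
    eval z (amplitudePoly x) = star x ⬝ᵥ tensorVec fun _ : Fin t => z := by
  simp only [amplitudePoly, map_sum, map_mul, eval_C, map_prod, eval_X, dotProduct, Pi.star_apply,
    tensorVec]

lemma star_dotProduct_vecMulVec_star_mulVec {A : Type*} [Fintype A] (u x : A → ℂ) :
    star x ⬝ᵥ (vecMulVec u (star u) *ᵥ x) = star (star x ⬝ᵥ u) * (star x ⬝ᵥ u) := by
  rw [vecMulVec_mulVec, dotProduct_smul, op_smul_eq_smul, smul_eq_mul, star_dotProduct]

variable {m n t : ℕ}

lemma haarCopies_form_mul_ascFactorial (x : (Fin t → Bits n) → ℂ) :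
    (star x ⬝ᵥ (haarCopies n t *ᵥ x)) * (2 ^ n).ascFactorial t =
      fischerForm (amplitudePoly x) (amplitudePoly x) := by
  rw [haarCopies, dotProduct_integral_mulVec fun a b =>
    integrable_haarState_of_continuous (continuous_copies_apply t a b)]
  simp only [copies_eq_vecMulVec, star_dotProduct_vecMulVec_star_mulVec, ← eval_amplitudePoly]
  exact integral_haarState_mul_ascFactorial (isHomogeneous_amplitudePoly x)
    (isHomogeneous_amplitudePoly x)

lemma independentState_form (x : ∀ i, PartyReg m n t i → ℂ) :
    star (tensorVec x) ⬝ᵥ (independentState m n t *ᵥ tensorVec x) =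
      ∏ i, star (x i) ⬝ᵥ (haarCopies n t *ᵥ x i) := by
  rw [independentState, tensor_mulVec_tensorVec, star_tensorVec, tensorVec_dotProduct_tensorVec]

lemma sharedState_form_mul_ascFactorial (x : ∀ i, PartyReg m n t i → ℂ) :
    (star (tensorVec x) ⬝ᵥ (sharedState m n t *ᵥ tensorVec x)) * (2 ^ n).ascFactorial (m * t) =
      fischerForm (∏ i, amplitudePoly (x i)) (∏ i, amplitudePoly (x i)) := by
  have homogeneous : (∏ i, amplitudePoly (x i)).IsHomogeneous (m * t) := by
    simpa using IsHomogeneous.prod univ _ _ fun i _ => isHomogeneous_amplitudePoly (x i)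
  rw [← integral_haarState_mul_ascFactorial homogeneous homogeneous, sharedState,
    dotProduct_integral_mulVec fun a b =>
      integrable_haarState_of_continuous (continuous_tensor_copies_apply m t a b)]
  simp only [tensor_copies_eq_vecMulVec, star_dotProduct_vecMulVec_star_mulVec]
  simp only [star_tensorVec, tensorVec_dotProduct_tensorVec, map_prod, eval_amplitudePoly]

lemma ascFactorial_pos {N : ℕ} (hN : 0 < N) (k : ℕ) : 0 < N.ascFactorial k :=
  (pow_pos hN k).trans_le (Nat.pow_succ_le_ascFactorial N k)

lemma isBlockPositive_independentState (m n t : ℕ) : IsBlockPositive (independentState m n t) := by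
  intro x
  rw [independentState_form]
  refine prod_nonneg fun i _ => ?_
  have asc_pos : (0 : ℂ) < ((2 ^ n).ascFactorial t : ℕ) :=
    Nat.cast_pos.2 (ascFactorial_pos (by positivity) _)
  refine le_of_mul_le_mul_right ?_ asc_pos
  rw [zero_mul, haarCopies_form_mul_ascFactorial]
  exact fischerForm_self_nonneg _

lemma one_sub_sq_div_mul_ascFactorial_le {N : ℕ} (hN : 0 < N) (k : ℕ) :
    (1 - (k : ℝ) ^ 2 / N) * N.ascFactorial k ≤ (N : ℝ) ^ k := by
  have asc_le : (N.ascFactorial k : ℝ) ≤ (N + k : ℝ) ^ k := by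
    obtain ⟨M, rfl⟩ := Nat.exists_eq_succ_of_ne_zero hN.ne'
    refine (Nat.cast_le.2 (Nat.ascFactorial_le_pow_add M k)).trans ?_
    push_cast
    gcongr
    linarith
  have bernoulli : 1 - (k : ℝ) ^ 2 / N ≤ (N / (N + k) : ℝ) ^ k := by
    have ratio : (N / (N + k) : ℝ) = 1 + -(k / (N + k)) := by field_simp; ring
    have le_one : (k / (N + k) : ℝ) ≤ 1 := div_le_one_of_le₀ (by linarith) (by positivity)
    calc 1 - (k : ℝ) ^ 2 / N ≤ 1 - (k : ℝ) ^ 2 / (N + k) := by gcongr; linarith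
      _ = 1 + k * -(k / (N + k) : ℝ) := by ring
      _ ≤ (N / (N + k) : ℝ) ^ k := ratio ▸ one_add_mul_le_pow (by linarith) k
  calc _ ≤ (N / (N + k) : ℝ) ^ k * (N + k : ℝ) ^ k := by gcongr
    _ = (N : ℝ) ^ k := by rw [← mul_pow, div_mul_cancel₀]; positivity

lemma one_sub_sq_mul_sq_div_mul_ascFactorial_mul_le {N : ℕ} (hN : 0 < N) (m t : ℕ) :
    (1 - (m : ℝ) ^ 2 * (t : ℝ) ^ 2 / N) * N.ascFactorial (m * t) ≤ (N.ascFactorial t : ℝ) ^ m := by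
  have ascFactorial_le := one_sub_sq_div_mul_ascFactorial_le hN (m * t)
  rw [Nat.cast_mul, mul_pow] at ascFactorial_le
  refine ascFactorial_le.trans ?_
  rw [mul_comm m, pow_mul]
  gcongr
  exact_mod_cast Nat.pow_succ_le_ascFactorial N t

lemma isBlockPositive_sharedState_sub (m n t : ℕ) :
    IsBlockPositive (sharedState m n t -
      (1 - (m : ℝ) ^ 2 * (t : ℝ) ^ 2 / 2 ^ n) • independentState m n t) := by
  intro x
  set q := star (tensorVec x) ⬝ᵥ (independentState m n t *ᵥ tensorVec x) with hq
  have bombieri : q * ((2 ^ n).ascFactorial t : ℂ) ^ m ≤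
      (star (tensorVec x) ⬝ᵥ (sharedState m n t *ᵥ tensorVec x)) *
        (2 ^ n).ascFactorial (m * t) := by
    rw [sharedState_form_mul_ascFactorial, hq, independentState_form, ← Fin.prod_const,
      ← prod_mul_distrib]
    simp only [haarCopies_form_mul_ascFactorial]
    exact prod_fischerForm_self_le _ fun i _ => isHomogeneous_amplitudePoly (x i)
  have asc_pos : (0 : ℂ) < ((2 ^ n).ascFactorial (m * t) : ℕ) :=
    Nat.cast_pos.2 (ascFactorial_pos (by positivity) _)
  have comparison := Complex.real_le_real.2
    (one_sub_sq_mul_sq_div_mul_ascFactorial_mul_le (pow_pos two_pos n) m t)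
  rw [sub_mulVec, dotProduct_sub, smul_mulVec, dotProduct_smul, ← hq, sub_nonneg]
  refine le_of_mul_le_mul_right ?_ asc_pos
  refine le_trans ?_ bombieri
  rw [Complex.real_smul, mul_right_comm, mul_comm]
  exact mul_le_mul_of_nonneg_left (by exact_mod_cast comparison)
    (isBlockPositive_independentState m n t x)

end QuadraticForms

end HaarLOCC

theorem mainTheorem11 :
    ∃ C : ℝ, 0 < C ∧ ∀ m n t : ℕ,
      HaarLOCC.LOCCIndistinguishable (C * ((m : ℝ) ^ 2 * (t : ℝ) ^ 2 / 2 ^ n))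
        (HaarLOCC.sharedState m n t) (HaarLOCC.independentState m n t) := by
  refine ⟨1, one_pos, fun m n t => ?_⟩
  rw [one_mul]
  exact HaarLOCC.loccIndistinguishable_of_isBlockPositive
    (HaarLOCC.trace_sharedState m n t) (HaarLOCC.trace_independentState m n t)
    (HaarLOCC.isBlockPositive_independentState m n t)
    (HaarLOCC.isBlockPositive_sharedState_sub m n t)
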